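/- **Setting.** Let $G$ be the distribution function of a probability law on $\{0,1,2,\dots\}$ with regularly varying tail of exponent $1/\gamma$, $\gamma>0$: $1-G(x)=L(x)x^{-1/\gamma}$ for all $x>0$, where $L$ is slowly varying, i.e. $\lim_{x\to\infty}L(tx)/L(x)=1$ for every $t>0$. Let $a$ be the left-continuous inverse of $1/(1-G)$, $a(y)=\inf\{x\ge 0: 1/(1-G(x))\ge y\}$. Consider a bipartite graph $(V,W,E)$, $E\subseteq V\times W$, with $|V|=N$, $|W|=M$; the in-degree of $w\in W$ is the number of $v\in V$ with $(v,w)\in E$. One API request returns either the set of out-neighbours of a node of $V$ or the in-degree of a node of $W$. The *two-stage algorithm* with parameters $n_1$ and $n_2\le M$ picks $n_1$ nodes of $V$ independently and uniformly at random (with replacement), requests the out-neighbours of each of them, and lets $S[w]$ be the number of picked nodes (with multiplicity) that have an edge to $w$; it then requests the in-degrees of $n_2$ nodes of $W$ with the $n_2$ largest values of $S$, ties being broken arbitrarily, and outputs these $n_2$ nodes with their in-degrees. It makes $n=n_1+n_2$ API requests. It *finds a fraction $1-\varepsilon$ of the top-$k$ nodes* if its output contains at least $(1-\varepsilon)k$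 elements of the set of $k$ nodes of $W$ with the largest in-degrees (of every such set, and for every way of breaking ties). The graph is random, and its in-degrees are independent realizations of $G$, in the following sense. Let $\xi_w$, $w\in W$, be i.i.d. with distribution function $G$. Since no in-degree can exceed $N$, it is required that almost surely, on the event $A=\{\xi_w\le N \text{ for all } w\in W\}$, the in-degree of every $w$ equals $\xi_w$; nothing else is assumed about the graph. The nodes picked by the algorithm are independent of the graph and of $(\xi_w)$. **Theorem.** 1. There is a slowly varying function $l$ such that $a(y)=l(y)\,y^{\gamma}$ for all $y>0$. 2. $N/a(N)=o(N)$ as $N\to\infty$; so for $M=N$ the bound $O(N/a(M))$ below is sublinear. 3. For all fixed $k\ge 1$ and $\varepsilon,\delta,c>0$ there are constants $C,c_0>0$ and $M_0$ such that for all $M,N\ge M_0$ with $N\ge c\,a(M)$ there are $n_1$ and $n_2\le M$ with $$n=n_1+n_2\le C\,\frac{N}{a(M)}$$ for which the following holds for every random graph as above. Given $A$, the two-stage algorithm finds a fraction $1-\varepsilon$ of the top-$k$ nodes with at most $C\,N/a(M)$ API requests with conditional probability at least $1-\delta$. If moreover $N\ge c_0\,a(M)$, then it does so with unconditional probability at least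 $1-\delta$. -/

import Mathlib

open MeasureTheory ProbabilityTheory Filter Topology Asymptotics

/-! ### Regular variation -/

/-- `L(t x) / L(x) → 1` as `x → ∞`, for every `t > 0`. (A function that vanishes at arbitrarily
large points is excluded, because then the quotient is `0` there.) -/
def SlowlyVarying (L : ℝ → ℝ) : Prop :=
  ∀ t : ℝ, 0 < t → Tendsto (fun x => L (t * x) / L x) atTop (𝓝 1)

/-- The distribution function `G` of a law `ν` on `{0, 1, 2, …}`. -/
noncomputable def distFun (ν : Measure ℕ) (x : ℝ) : ℝ :=
  cdf (ν.map (fun j : ℕ => (j : ℝ))) x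

/-- `1 - G(x) = L(x) x^(-1/γ)` for all `x > 0`, with `L` slowly varying. -/
def RegularlyVaryingTail (ν : Measure ℕ) (γ : ℝ) : Prop :=
  ∃ L : ℝ → ℝ, SlowlyVarying L ∧ ∀ x : ℝ, 0 < x → 1 - distFun ν x = L x * x ^ (-1 / γ)

/-- The left-continuous inverse of `1 / (1 - G)` (where `G < 1` everywhere, as is the case for
a regularly varying tail): `a(y) = inf {x ≥ 0 : 1 / (1 - G(x)) ≥ y}`. -/
noncomputable def tailInverse (ν : Measure ℕ) (y : ℝ) : ℝ :=
  sInf {x : ℝ | 0 ≤ x ∧ y ≤ 1 / (1 - distFun ν x)}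

/-! ### Bipartite graphs, given by their set `E ⊆ V × W` of edges -/

section Graph

variable {V W : Type*} [Fintype V] [Fintype W] [DecidableEq V] [DecidableEq W]

def outNbrs (E : Finset (V × W)) (v : V) : Finset W :=
  Finset.univ.filter fun w => (v, w) ∈ E

def inDeg (E : Finset (V × W)) (w : W) : ℕ :=
  (Finset.univ.filter fun v => (v, w) ∈ E).card

/-- `T` consists of `k` nodes with the `k` largest values of `f` (ties broken arbitrarily). -/
def IsTopSet (k : ℕ) (f : W → ℕ) (T : Finset W) : Prop :=
  T.card = k ∧ ∀ u ∈ T, ∀ w, w ∉ T → f w ≤ f u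

end Graph

/-! ### Programs that know the graph only through API requests -/

/-- A program that may ask for the out-neighbours of a node of `V` or for the in-degree of a node
of `W`, and continues according to the answer. -/
inductive ApiProgram (V W α : Type*) where
  | done (a : α) : ApiProgram V W α
  | askOutNbrs (v : V) (next : Finset W → ApiProgram V W α) : ApiProgram V W α
  | askInDeg (w : W) (next : ℕ → ApiProgram V W α) : ApiProgram V W α

section Algorithm

variable {V W : Type*}

/-- Runs a program on the graph `E`; returns its output and the number of API requests made. -/
def ApiProgram.run [Fintype V] [Fintype W] [DecidableEq V] [DecidableEq W] {α : Type*}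
    (E : Finset (V × W)) : ApiProgram V W α → α × ℕ
  | .done a => (a, 0)
  | .askOutNbrs v next => (((next (outNbrs E v)).run E).1, ((next (outNbrs E v)).run E).2 + 1)
  | .askInDeg w next => (((next (inDeg E w)).run E).1, ((next (inDeg E w)).run E).2 + 1)

/-- First stage: for each `v` in the list, ask for its out-neighbours and add `1` to `S w` for
each of them; then continue with the final `S`. -/
def firstStage [DecidableEq W] {α : Type*} :
    List V → (W → ℕ) → ((W → ℕ) → ApiProgram V W α) → ApiProgram V W α
  | [], S, next => next S
  | v :: vs, S, next =>
      .askOutNbrs v fun A => firstStage vs (fun w => if w ∈ A then S w + 1 else S w) next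

/-- Second stage: ask for the in-degree of each node in the list, and output the nodes with
their in-degrees. -/
def secondStage : List W → List (W × ℕ) → ApiProgram V W (List (W × ℕ))
  | [], acc => .done acc
  | w :: ws, acc => .askInDeg w fun d => secondStage ws (acc ++ [(w, d)])

/-- The two-stage algorithm. `vs` is the list of randomly chosen nodes of `V`, and `top` is the
rule that lists the candidate nodes once `S` is known. -/
def twoStage [DecidableEq W] (vs : List V) (top : (W → ℕ) → List W) :
    ApiProgram V W (List (W × ℕ)) :=
  firstStage vs (fun _ => 0) fun S => secondStage (top S) []

/-- `top S` lists `n₂` distinct nodes with the `n₂` largest values of `S`, for every `S`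
(ties broken in any way). -/
def IsTopRule [DecidableEq W] (n₂ : ℕ) (top : (W → ℕ) → List W) : Prop :=
  ∀ S : W → ℕ, (top S).Nodup ∧ IsTopSet n₂ S (top S).toFinset

/-- On the graph `E`, with the nodes `vs` chosen in the first stage and `n₂` candidates in the
second, the two-stage algorithm makes at most `B` API requests and its output contains at least a
fraction `1 - ε` of the top-`k` nodes of `W`, however ties are broken. -/
def FindsTop [Fintype V] [Fintype W] [DecidableEq V] [DecidableEq W]
    (k : ℕ) (ε B : ℝ) (n₂ : ℕ) (E : Finset (V × W)) (vs : List V) : Prop :=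
  ∀ top : (W → ℕ) → List W, IsTopRule n₂ top →
    (((twoStage vs top).run E).2 : ℝ) ≤ B ∧
    ∀ T : Finset W, IsTopSet k (inDeg E) T →
      (1 - ε) * (k : ℝ) ≤
        ((T.filter fun w => w ∈ ((twoStage vs top).run E).1.map Prod.fst).card : ℝ)

end Algorithm

/-- The law of `n₁` independent uniformly distributed nodes of `{0, …, N - 1}`. -/
noncomputable def uniformSamples (N n₁ : ℕ) : Measure (Fin n₁ → Fin N) :=
  Measure.pi fun _ => uniformOn Set.univ

/-!
Write `α = 1 / γ` and `a = tailInverse ν`.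

*Regular variation.* The Galois connection `a(y) ≤ x ↔ y (1 - G(x)) ≤ 1` turns the regular
variation of the tail into `y (1 - G(t a(y))) → t ^ (-α)` for every `t > 0`
(`RegularlyVaryingTail.tendsto_mul_tailFun`). This yields `a(t y) / a(y) → t ^ γ`, hence the
slow variation of `a(y) / y ^ γ`; and it says that of `M` independent degrees about `t ^ (-α)`
exceed `t a(M)`.

*The algorithm.* Fix an integer `q` above the tail exponent. Given the graph, `S[w]` counts the
successes in `n₁` independent trials with success probability `inDeg w / N`. Three facts, each of
which holds with high probability, make the algorithm find all of the top-`k` nodes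
(`findsTop_of_hits`):
* for a small constant `x`, at least `k` degrees exceed `x a(M)`, so that the top-`k` nodes are
  among those with such a degree;
* if `n₁` is a large multiple of `N / a(M)`, then each of these boundedly many nodes is hit at
  least `q` times;
* the number of all nodes that are hit at least `q` times is at most a constant `n₂`.

The first two are lower tail estimates for independent trials, and both follow by cutting the trials
into blocks (`measure_card_lt_le`). For the third, a node of degree `d` is hit at least `q` times
with probability at most `min 1 ((n₁ d / N) ^ q)`, which is `O(min 1 ((d / a(M)) ^ q))`. Since `q`
exceeds the tail exponent, the expected sum of these bounds over the `M` nodes stays bounded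
(`RegularlyVaryingTail.exists_moment_bound`), and Markov's inequality applies. As `N / a(M) ≥ c`, a
constant `n₂` is also `O(N / a(M))`.

*Conditioning.* On the event `A` that no `ξ w` exceeds `N`, all of this is bounded in terms of the
unconditional law of the `ξ w` (`prod_not_findsTop_le`). When `N ≥ c a(M)`, the probability of `A`
is bounded below by a positive constant, so conditioning on `A` costs a constant factor in the
probability of failure; when `N ≥ c₀ a(M)` with `c₀` large, `A` has probability close to `1`.
-/

/-! ### Regular variation of the tail and of its inverse -/

/-- The tail `1 - G` of the law `ν`. -/
noncomputable def tailFun (ν : Measure ℕ) (x : ℝ) : ℝ := 1 - distFun ν x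

section RegularVariation

variable {ν : Measure ℕ}

theorem isProbabilityMeasure_map_cast (ν : Measure ℕ) [IsProbabilityMeasure ν] :
    IsProbabilityMeasure (ν.map (fun j : ℕ => (j : ℝ))) :=
  Measure.isProbabilityMeasure_map (measurable_of_countable _).aemeasurable

theorem tailFun_eq_measureReal [IsProbabilityMeasure ν] (x : ℝ) :
    tailFun ν x = ν.real {j : ℕ | x < j} := by
  have := isProbabilityMeasure_map_cast ν
  have h : {j : ℕ | x < j} = ((fun j : ℕ => (j : ℝ)) ⁻¹' Set.Iic x)ᶜ := by
    ext j; simp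
  rw [tailFun, distFun, cdf_eq_real, map_measureReal_apply (measurable_of_countable _)
    measurableSet_Iic, h, probReal_compl_eq_one_sub (MeasurableSet.of_discrete)]

theorem tailFun_antitone (ν : Measure ℕ) : Antitone (tailFun ν) := fun _ _ h =>
  sub_le_sub_left (monotone_cdf _ h) 1

theorem tailFun_nonneg (ν : Measure ℕ) (x : ℝ) : 0 ≤ tailFun ν x :=
  sub_nonneg.2 (cdf_le_one _ x)

theorem tailFun_le_one (ν : Measure ℕ) (x : ℝ) : tailFun ν x ≤ 1 :=
  sub_le_self _ (cdf_nonneg _ x)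

theorem tendsto_tailFun_atTop (ν : Measure ℕ) : Tendsto (tailFun ν) atTop (𝓝 0) := by
  have h := (tendsto_cdf_atTop (ν.map (fun j : ℕ => (j : ℝ)))).const_sub 1
  rwa [sub_self] at h

theorem tailFun_tendsto_right (ν : Measure ℕ) (x : ℝ) :
    Tendsto (tailFun ν) (𝓝[>] x) (𝓝 (tailFun ν x)) := by
  have h := ((cdf (ν.map (fun j : ℕ => (j : ℝ)))).right_continuous x).mono_left
    (nhdsWithin_mono x Set.Ioi_subset_Ici_self)
  exact Tendsto.const_sub 1 h

variable {γ : ℝ}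

theorem RegularlyVaryingTail.tendsto_ratio (hν : RegularlyVaryingTail ν γ) {t : ℝ} (ht : 0 < t) :
    Tendsto (fun x => tailFun ν (t * x) / tailFun ν x) atTop (𝓝 (t ^ (-1 / γ))) := by
  obtain ⟨L, hL, h⟩ := hν
  have := (hL t ht).mul_const (t ^ (-1 / γ))
  rw [one_mul] at this
  refine this.congr' ?_
  filter_upwards [eventually_gt_atTop 0] with x hx
  rw [tailFun, tailFun, h _ (mul_pos ht hx), h _ hx, Real.mul_rpow ht.le hx.le]
  have := (Real.rpow_pos_of_pos hx (-1 / γ)).ne'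
  by_cases h0 : L x = 0
  · simp [h0]
  · field_simp

theorem RegularlyVaryingTail.tailFun_pos (hν : RegularlyVaryingTail ν γ) (x : ℝ) :
    0 < tailFun ν x := by
  have h := (hν.tendsto_ratio one_pos).eventually_ne (by simp : (1 : ℝ) ^ (-1 / γ) ≠ 0)
  obtain ⟨y, hy, hxy⟩ := (h.and (eventually_ge_atTop x)).exists
  refine lt_of_lt_of_le (lt_of_le_of_ne (tailFun_nonneg ν y) fun h0 => hy ?_)
    (tailFun_antitone ν hxy)
  simp [← h0]

/-- The Galois connection that characterizes the generalized inverse; right continuity of the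
tail gives the implication from left to right. -/
theorem RegularlyVaryingTail.tailInverse_le_iff (hν : RegularlyVaryingTail ν γ) {x y : ℝ}
    (hx : 0 ≤ x) (hy : 0 < y) : tailInverse ν y ≤ x ↔ y * tailFun ν x ≤ 1 := by
  have hset : {x : ℝ | 0 ≤ x ∧ y ≤ 1 / (1 - distFun ν x)} =
      {x : ℝ | 0 ≤ x ∧ y * tailFun ν x ≤ 1} := by
    ext z
    have hz := hν.tailFun_pos z
    exact and_congr_right fun _ => le_div_iff₀ hz
  rw [tailInverse, hset]
  have hbdd : BddBelow {x : ℝ | 0 ≤ x ∧ y * tailFun ν x ≤ 1} := ⟨0, fun z hz => hz.1⟩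
  refine ⟨fun h => ?_, fun h => csInf_le hbdd ⟨hx, h⟩⟩
  have hne : {x : ℝ | 0 ≤ x ∧ y * tailFun ν x ≤ 1}.Nonempty := by
    have h0 : Tendsto (fun z => y * tailFun ν z) atTop (𝓝 0) := by
      simpa using (tendsto_tailFun_atTop ν).const_mul y
    obtain ⟨z, hz, hz0⟩ := ((h0.eventually_le_const one_pos).and (eventually_ge_atTop 0)).exists
    exact ⟨z, hz0, hz⟩
  refine le_of_tendsto ((tailFun_tendsto_right ν x).const_mul y) ?_
  filter_upwards [self_mem_nhdsWithin] with z hz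
  obtain ⟨u, hu, huz⟩ := exists_lt_of_csInf_lt hne (h.trans_lt hz)
  exact (mul_le_mul_of_nonneg_left (tailFun_antitone ν huz.le) hy.le).trans hu.2

theorem tailInverse_nonneg (ν : Measure ℕ) (y : ℝ) : 0 ≤ tailInverse ν y :=
  Real.sInf_nonneg fun _ hx => hx.1

theorem RegularlyVaryingTail.mul_tailFun_tailInverse_le (hν : RegularlyVaryingTail ν γ) {y : ℝ}
    (hy : 0 < y) : y * tailFun ν (tailInverse ν y) ≤ 1 :=
  (hν.tailInverse_le_iff (tailInverse_nonneg ν y) hy).1 le_rfl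

theorem RegularlyVaryingTail.tendsto_tailInverse (hν : RegularlyVaryingTail ν γ) :
    Tendsto (tailInverse ν) atTop atTop := by
  refine tendsto_atTop.2 fun b => ?_
  have hb := hν.tailFun_pos (max b 0)
  filter_upwards [eventually_gt_atTop (1 / tailFun ν (max b 0)), eventually_gt_atTop 0]
    with y hy hy0
  refine (le_max_left b 0).trans (le_of_lt ?_)
  rw [← not_le, hν.tailInverse_le_iff (le_max_right b 0) hy0, not_le]
  exact (div_lt_iff₀ hb).1 hy

/-- The tail may jump at `a(y)`, but the jumps are asymptotically negligible. -/
theorem RegularlyVaryingTail.tendsto_mul_tailFun_tailInverse (hν : RegularlyVaryingTail ν γ) :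
    Tendsto (fun y => y * tailFun ν (tailInverse ν y)) atTop (𝓝 1) := by
  have ha := hν.tendsto_tailInverse
  refine tendsto_order.2 ⟨fun b hb => ?_, fun b hb => ?_⟩
  · -- Since `1 < y (1 - G)(s a(y))` for `s < 1`, it suffices to take `s` with `b < s ^ (1 / γ)`.
    have hcont : Tendsto (fun s : ℝ => s ^ (-1 / γ) * b) (𝓝[<] 1) (𝓝 (1 * b)) := by
      have h1 : ContinuousAt (fun s : ℝ => s ^ (-1 / γ)) 1 :=
        Real.continuousAt_rpow_const _ _ (Or.inl one_ne_zero)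
      have h2 : Tendsto (fun s : ℝ => s ^ (-1 / γ)) (𝓝 1) (𝓝 1) := by
        simpa [ContinuousAt] using h1
      exact (h2.mono_left nhdsWithin_le_nhds).mul_const b
    rw [one_mul] at hcont
    have hpos : ∀ᶠ s : ℝ in 𝓝[<] 1, 0 < s :=
      nhdsWithin_le_nhds (eventually_gt_nhds one_pos)
    obtain ⟨s, hs, hs0, hs1⟩ := ((hcont.eventually_lt_const hb).and
      (hpos.and self_mem_nhdsWithin)).exists
    have hlim := (((hν.tendsto_ratio hs0).comp ha).mul_const b).eventually_lt_const hs
    filter_upwards [hlim, ha.eventually_gt_atTop 0, eventually_gt_atTop 0] with y hy hay hy0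
    have h1 : 1 < y * tailFun ν (s * tailInverse ν y) := by
      rw [← not_le, ← hν.tailInverse_le_iff (by positivity) hy0, not_le]
      exact mul_lt_of_lt_one_left hay hs1
    have hp := hν.tailFun_pos (tailInverse ν y)
    simp only [Function.comp] at hy
    rcases le_or_gt b 0 with hb0 | hb0
    · exact hb0.trans_lt (by positivity)
    · rw [div_mul_eq_mul_div, div_lt_one hp] at hy
      have := mul_lt_mul_of_pos_left hy hy0
      nlinarith
  · filter_upwards [eventually_gt_atTop 0] with y hy0
    exact (hν.mul_tailFun_tailInverse_le hy0).trans_lt hb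

theorem RegularlyVaryingTail.tendsto_mul_tailFun (hν : RegularlyVaryingTail ν γ) {t : ℝ}
    (ht : 0 < t) :
    Tendsto (fun y => y * tailFun ν (t * tailInverse ν y)) atTop (𝓝 (t ^ (-1 / γ))) := by
  have h := ((hν.tendsto_ratio ht).comp hν.tendsto_tailInverse).mul
    hν.tendsto_mul_tailFun_tailInverse
  rw [mul_one] at h
  refine h.congr fun y => ?_
  have := (hν.tailFun_pos (tailInverse ν y)).ne'
  simp only [Function.comp]
  field_simp

theorem RegularlyVaryingTail.tendsto_tailInverse_ratio (hγ : 0 < γ)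
    (hν : RegularlyVaryingTail ν γ) {t : ℝ} (ht : 0 < t) :
    Tendsto (fun y => tailInverse ν (t * y) / tailInverse ν y) atTop (𝓝 (t ^ γ)) := by
  have ha := hν.tendsto_tailInverse
  have htγ := Real.rpow_pos_of_pos ht γ
  have hinv : (t ^ γ) ^ (-1 / γ) = 1 / t := by
    rw [← Real.rpow_mul ht.le, mul_div_cancel₀ _ hγ.ne', Real.rpow_neg_one, one_div]
  have hneg : -1 / γ < 0 := div_neg_of_neg_of_pos (by norm_num) hγ
  refine tendsto_order.2 ⟨fun b hb => ?_, fun b hb => ?_⟩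
  · rcases lt_or_ge b 0 with hb0 | hb0
    · filter_upwards with y
      exact hb0.trans_le (div_nonneg (tailInverse_nonneg _ _) (tailInverse_nonneg _ _))
    obtain ⟨s, hbs, hs⟩ := exists_between hb
    have hs0 := hb0.trans_lt hbs
    have hlt : 1 / t < s ^ (-1 / γ) := hinv ▸ Real.rpow_lt_rpow_of_neg hs0 hs hneg
    filter_upwards [(hν.tendsto_mul_tailFun hs0).eventually_const_lt hlt,
      ha.eventually_gt_atTop 0, eventually_gt_atTop 0] with y hy hay hy0
    rw [div_lt_iff₀ ht] at hy
    refine hbs.trans ((lt_div_iff₀ hay).2 ?_)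
    rw [← not_le, hν.tailInverse_le_iff (by positivity) (by positivity), not_le]
    linarith
  · have hb0 := htγ.trans hb
    obtain ⟨s, hs, hsb⟩ := exists_between hb
    have hs0 := htγ.trans hs
    have hlt : s ^ (-1 / γ) < 1 / t := hinv ▸ Real.rpow_lt_rpow_of_neg htγ hs hneg
    filter_upwards [(hν.tendsto_mul_tailFun hs0).eventually_lt_const hlt,
      ha.eventually_gt_atTop 0, eventually_gt_atTop 0] with y hy hay hy0
    rw [lt_div_iff₀ ht] at hy
    refine lt_of_le_of_lt ((div_le_iff₀ hay).2 ?_) hsb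
    rw [hν.tailInverse_le_iff (by positivity) (by positivity)]
    linarith

theorem RegularlyVaryingTail.exists_slowlyVarying (hγ : 0 < γ) (hν : RegularlyVaryingTail ν γ) :
    ∃ l : ℝ → ℝ, SlowlyVarying l ∧ ∀ y : ℝ, 0 < y → tailInverse ν y = l y * y ^ γ := by
  refine ⟨fun y => tailInverse ν y / y ^ γ, fun t ht => ?_, fun y hy => ?_⟩
  · have htγ := Real.rpow_pos_of_pos ht γ
    have h := (hν.tendsto_tailInverse_ratio hγ ht).div_const (t ^ γ)
    rw [div_self htγ.ne'] at h
    refine h.congr' ?_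
    filter_upwards [eventually_gt_atTop 0] with y hy
    have := Real.rpow_pos_of_pos hy γ
    rw [Real.mul_rpow ht.le hy.le, div_div_div_eq]
    field_simp
  · have := (Real.rpow_pos_of_pos hy γ).ne'
    field_simp

/-- A bound of Potter type, along the dyadic fractions of `a(y)`. With `x₀` such that halving the
argument multiplies the tail at most by `2 ^ β` above `x₀`, the function `tailFun ν (max x x₀)` has
the same property everywhere. -/
theorem RegularlyVaryingTail.exists_dyadic_bound (hν : RegularlyVaryingTail ν γ) :
    ∃ (C : ℝ) (β : ℕ), 0 < C ∧ ∀ y : ℝ, 0 < y → ∀ j : ℕ,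
      y * tailFun ν (tailInverse ν y / 2 ^ j) ≤ C * (2 ^ β) ^ j := by
  obtain ⟨β, hβ⟩ := pow_unbounded_of_one_lt ((1 / 2 : ℝ) ^ (-1 / γ)) one_lt_two
  obtain ⟨x₀, hx₀⟩ := eventually_atTop.1 <|
    (hν.tendsto_ratio (t := 1 / 2) (by norm_num)).eventually_lt_const hβ
  have hdouble : ∀ x, x₀ ≤ x → tailFun ν (x / 2) ≤ 2 ^ β * tailFun ν x := fun x hx => by
    have := hx₀ x hx
    rw [div_lt_iff₀ (hν.tailFun_pos x)] at this
    rw [div_eq_inv_mul, ← one_div]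
    exact this.le
  have htrunc : ∀ x, 0 ≤ x → tailFun ν (max (x / 2) x₀) ≤ 2 ^ β * tailFun ν (max x x₀) := by
    intro x h0
    rcases le_total x₀ x with h | h
    · rw [max_eq_left h]
      exact (tailFun_antitone ν (le_max_left _ _)).trans (hdouble x h)
    · rw [max_eq_right h, max_eq_right ((half_le_self h0).trans h)]
      exact le_mul_of_one_le_left (tailFun_nonneg ν _) (one_le_pow₀ one_le_two)
  have hp := hν.tailFun_pos x₀
  refine ⟨1 / tailFun ν x₀, β, by positivity, fun y hy j => ?_⟩
  have hiter : y * tailFun ν (max (tailInverse ν y / 2 ^ j) x₀) ≤ (2 ^ β) ^ j := by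
    induction j with
    | zero =>
      rw [pow_zero, pow_zero, div_one]
      exact (mul_le_mul_of_nonneg_left (tailFun_antitone ν (le_max_left _ _)) hy.le).trans
        (hν.mul_tailFun_tailInverse_le hy)
    | succ j ih =>
      rw [pow_succ, ← div_div, pow_succ ((2 : ℝ) ^ β)]
      have := htrunc (tailInverse ν y / 2 ^ j) (div_nonneg (tailInverse_nonneg _ _) (by positivity))
      calc _ ≤ y * (2 ^ β * tailFun ν (max (tailInverse ν y / 2 ^ j) x₀)) := by gcongr
        _ = y * tailFun ν (max (tailInverse ν y / 2 ^ j) x₀) * 2 ^ β := by ring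
        _ ≤ _ := by gcongr
  have hcmp : tailFun ν x₀ * tailFun ν (tailInverse ν y / 2 ^ j) ≤
      tailFun ν (max (tailInverse ν y / 2 ^ j) x₀) := by
    rcases le_total (tailInverse ν y / 2 ^ j) x₀ with h | h
    · rw [max_eq_right h]
      exact mul_le_of_le_one_right hp.le (tailFun_le_one _ _)
    · rw [max_eq_left h]
      exact mul_le_of_le_one_left (tailFun_nonneg _ _) (tailFun_le_one _ _)
  rw [one_div, inv_mul_eq_div, le_div_iff₀ hp]
  calc _ = y * (tailFun ν x₀ * tailFun ν (tailInverse ν y / 2 ^ j)) := by ring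
    _ ≤ y * tailFun ν (max (tailInverse ν y / 2 ^ j) x₀) := by gcongr
    _ ≤ _ := hiter

end RegularVariation

/-! ### Runs of the two-stage algorithm on a fixed graph -/

section Hits

variable {V W : Type*} [DecidableEq V] [DecidableEq W]

/-- `S[w]`: the number of picks, with multiplicity, that have an edge to `w`. -/
def hits {n : ℕ} (E : Finset (V × W)) (v : Fin n → V) (w : W) : ℕ :=
  (Finset.univ.filter fun i => (v i, w) ∈ E).card

theorem countP_ofFn {n : ℕ} (E : Finset (V × W)) (v : Fin n → V) (w : W) :
    (List.ofFn v).countP (fun v => (v, w) ∈ E) = hits E v w := by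
  induction n with
  | zero => simp [hits]
  | succ n ih =>
    rw [List.ofFn_succ, List.countP_cons, ih, hits, hits, Fin.card_filter_univ_succ]
    by_cases h : (v 0, w) ∈ E <;> simp [h, add_comm]

end Hits

section Deterministic

variable {V W : Type*} [Fintype V] [Fintype W] [DecidableEq V] [DecidableEq W]

theorem run_firstStage {α : Type*} (E : Finset (V × W)) (vs : List V) (S : W → ℕ)
    (next : (W → ℕ) → ApiProgram V W α) :
    (firstStage vs S next).run E =
      (((next fun w => S w + vs.countP fun v => (v, w) ∈ E).run E).1,
        ((next fun w => S w + vs.countP fun v => (v, w) ∈ E).run E).2 + vs.length) := by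
  induction vs generalizing S with
  | nil => simp [firstStage]
  | cons v vs ih =>
    have h : (fun w => (if w ∈ outNbrs E v then S w + 1 else S w) +
        vs.countP fun v => (v, w) ∈ E) =
        fun w => S w + (v :: vs).countP fun v => (v, w) ∈ E := by
      funext w
      by_cases hw : (v, w) ∈ E <;> simp [outNbrs, hw]; ring
    simp only [firstStage, ApiProgram.run, ih, h, List.length_cons, add_assoc]

theorem run_secondStage (E : Finset (V × W)) (ws : List W) (acc : List (W × ℕ)) :
    (secondStage (V := V) ws acc).run E = (acc ++ ws.map fun w => (w, inDeg E w), ws.length) := by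
  induction ws generalizing acc with
  | nil => simp [secondStage, ApiProgram.run]
  | cons w ws ih => simp [secondStage, ApiProgram.run, ih]

theorem run_twoStage {n : ℕ} (E : Finset (V × W)) (v : Fin n → V) (top : (W → ℕ) → List W) :
    (twoStage (List.ofFn v) top).run E =
      ((top (hits E v)).map fun w => (w, inDeg E w), (top (hits E v)).length + n) := by
  have h : (fun w => 0 + (List.ofFn v).countP fun v => (v, w) ∈ E) = hits E v := by
    funext w
    rw [zero_add, countP_ofFn]
  rw [twoStage, run_firstStage, h]
  simp [run_secondStage]

/-- If at most `n` nodes have a value `≥ q`, then each of them belongs to every set of `n` nodes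
with the largest values. -/
theorem IsTopSet.mem_of_le {n q : ℕ} {f : W → ℕ} {T : Finset W} (hT : IsTopSet n f T)
    (hq : (Finset.univ.filter fun w => q ≤ f w).card ≤ n) {w : W} (hw : q ≤ f w) : w ∈ T := by
  by_contra hwT
  have hsub : insert w T ⊆ Finset.univ.filter fun w => q ≤ f w := by
    intro u hu
    rcases Finset.mem_insert.1 hu with rfl | hu
    · simpa using hw
    · simpa using hw.trans (hT.2 u hu w hwT)
  have := Finset.card_le_card hsub
  rw [Finset.card_insert_of_notMem hwT, hT.1] at this
  omega

/-- If at least `k` nodes have a value `> x`, then every set of `k` nodes with the largest values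
consists of such nodes. -/
theorem IsTopSet.lt_of_mem {k : ℕ} {f : W → ℕ} {T : Finset W} (hT : IsTopSet k f T) {x : ℝ}
    (hk : k ≤ (Finset.univ.filter fun w => x < f w).card) {u : W} (hu : u ∈ T) : x < f u := by
  by_contra hux
  have hsub : (Finset.univ.filter fun w => x < f w) ⊆ T.erase u := by
    intro w hw
    replace hw : x < f w := by simpa using hw
    refine Finset.mem_erase.2 ⟨fun h => hux (h ▸ hw), ?_⟩
    by_contra hwT
    have : (f w : ℝ) ≤ f u := by exact_mod_cast hT.2 u hu w hwT
    linarith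
  have := Finset.card_le_card hsub
  rw [Finset.card_erase_of_mem hu, hT.1] at this
  have : 0 < T.card := Finset.card_pos.2 ⟨u, hu⟩
  have := hT.1
  omega

/-- A deterministic criterion: at least `k` nodes have in-degree `> x`, each of these is hit at
least `q` times, and at most `n₂` nodes are hit at least `q` times. -/
theorem findsTop_of_hits {k n₁ n₂ q : ℕ} {ε B x : ℝ} (hε : 0 ≤ ε) (hB : ((n₁ + n₂ : ℕ) : ℝ) ≤ B)
    {E : Finset (V × W)} {v : Fin n₁ → V}
    (hk : k ≤ (Finset.univ.filter fun w => x < inDeg E w).card)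
    (hx : ∀ w, x < inDeg E w → q ≤ hits E v w)
    (hq : (Finset.univ.filter fun w => q ≤ hits E v w).card ≤ n₂) :
    FindsTop k ε B n₂ E (List.ofFn v) := by
  intro top htop
  obtain ⟨hnodup, hset⟩ := htop (hits E v)
  rw [run_twoStage]
  refine ⟨?_, fun T hT => ?_⟩
  · rw [← List.toFinset_card_of_nodup hnodup, hset.1, add_comm]
    exact hB
  · have hall : (T.filter fun w => w ∈ ((top (hits E v)).map fun w => (w, inDeg E w)).map
        Prod.fst) = T := by
      refine Finset.filter_true_of_mem fun w hw => ?_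
      have := hset.mem_of_le hq (hx w (hT.lt_of_mem hk hw))
      simpa using this
    rw [hall, hT.1]
    have : (0 : ℝ) ≤ k := Nat.cast_nonneg k
    nlinarith

end Deterministic

/-! ### Numbers of successes in independent trials -/

section Counting

variable {Ω β : Type*} [MeasurableSpace Ω] [MeasurableSpace β] {μ : Measure Ω}
  [IsProbabilityMeasure μ] {n : ℕ} {X : Fin n → Ω → β} {s : Set β} [DecidablePred (· ∈ s)]

/-- Lower tail of the number of successes in `n ≥ q m` independent trials: if there are fewer than
`q` successes, then one of `q` disjoint blocks of `m` trials contains none. -/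
theorem measure_card_lt_le (hX : ∀ i, Measurable (X i)) (hind : iIndepFun X μ)
    (hs : MeasurableSet s) {p : ℝ} (hp : ∀ i, p ≤ μ.real (X i ⁻¹' s)) {q m : ℕ}
    (hqm : q * m ≤ n) :
    μ {ω | (Finset.univ.filter fun i => X i ω ∈ s).card < q} ≤
      ENNReal.ofReal (q * Real.exp (-(p * m))) := by
  let e : Fin q × Fin m ↪ Fin n := finProdFinEquiv.toEmbedding.trans (Fin.castLEEmb hqm)
  let J : Fin q → Finset (Fin n) := fun b =>
    Finset.univ.map ((Function.Embedding.sectR b _).trans e)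
  have hsub : {ω | (Finset.univ.filter fun i => X i ω ∈ s).card < q} ⊆
      ⋃ b : Fin q, ⋂ i ∈ J b, X i ⁻¹' sᶜ := by
    intro ω hω
    by_contra hnot
    simp only [Set.mem_iUnion, Set.mem_iInter, not_exists, not_forall] at hnot
    choose i hi his using hnot
    have hinj : Function.Injective i := by
      intro b b' hbb
      obtain ⟨j, -, hj⟩ := Finset.mem_map.1 (hi b)
      obtain ⟨j', -, hj'⟩ := Finset.mem_map.1 (hi b')
      have := e.injective (hj.trans (hbb.trans hj'.symm))
      exact congrArg Prod.fst this
    refine absurd (Set.mem_ofPred.1 hω) (not_lt.2 ?_)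
    calc q = (Finset.univ.map ⟨i, hinj⟩).card := by simp
      _ ≤ _ := Finset.card_le_card fun j hj => by
        obtain ⟨b, -, rfl⟩ := Finset.mem_map.1 hj
        simpa using his b
  have hfail : ∀ i, μ (X i ⁻¹' sᶜ) ≤ ENNReal.ofReal (Real.exp (-p)) := by
    intro i
    rw [← ofReal_measureReal]
    refine ENNReal.ofReal_le_ofReal ?_
    rw [Set.preimage_compl, probReal_compl_eq_one_sub (hX i hs)]
    linarith [hp i, Real.add_one_le_exp (-p)]
  calc _ ≤ μ (⋃ b : Fin q, ⋂ i ∈ J b, X i ⁻¹' sᶜ) := measure_mono hsub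
    _ ≤ ∑ b : Fin q, μ (⋂ i ∈ J b, X i ⁻¹' sᶜ) := measure_iUnion_fintype_le _ _
    _ ≤ ∑ _b : Fin q, ENNReal.ofReal (Real.exp (-p)) ^ m := by
      refine Finset.sum_le_sum fun b _ => ?_
      rw [iIndepFun_iff_measure_inter_preimage_eq_mul.1 hind (J b) fun _ _ => hs.compl]
      refine (Finset.prod_le_pow_card _ _ _ fun i _ => hfail i).trans (le_of_eq ?_)
      simp [J]
    _ = _ := by
      rw [← ENNReal.ofReal_pow (Real.exp_pos _).le, ← Real.exp_nat_mul, Finset.sum_const,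
        Finset.card_univ, Fintype.card_fin, nsmul_eq_mul, ENNReal.ofReal_mul (by positivity),
        ENNReal.ofReal_natCast]
      congr 3
      ring

/-- Upper tail of the number of successes: the union bound over the sets of `q` trials. -/
theorem measure_le_card_le (hind : iIndepFun X μ) (hs : MeasurableSet s) {p : ℝ} (hp0 : 0 ≤ p)
    (hp : ∀ i, μ.real (X i ⁻¹' s) ≤ p) (q : ℕ) :
    μ {ω | q ≤ (Finset.univ.filter fun i => X i ω ∈ s).card} ≤
      ENNReal.ofReal ((n * p) ^ q) := by
  have hsub : {ω | q ≤ (Finset.univ.filter fun i => X i ω ∈ s).card} ⊆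
      ⋃ I ∈ (Finset.univ : Finset (Fin n)).powersetCard q, ⋂ i ∈ I, X i ⁻¹' s := by
    intro ω hω
    obtain ⟨I, hI, hcard⟩ := Finset.exists_subset_card_eq hω
    refine Set.mem_biUnion (x := I) (by simpa using hcard) ?_
    simp only [Set.mem_iInter]
    intro i hi
    simpa using hI hi
  have hsucc : ∀ i, μ (X i ⁻¹' s) ≤ ENNReal.ofReal p := fun i => by
    rw [← ofReal_measureReal]
    exact ENNReal.ofReal_le_ofReal (hp i)
  calc _ ≤ μ _ := measure_mono hsub
    _ ≤ ∑ I ∈ (Finset.univ : Finset (Fin n)).powersetCard q, μ (⋂ i ∈ I, X i ⁻¹' s) :=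
      measure_biUnion_finset_le _ _
    _ ≤ ∑ I ∈ (Finset.univ : Finset (Fin n)).powersetCard q, ENNReal.ofReal p ^ q := by
      refine Finset.sum_le_sum fun I hI => ?_
      rw [iIndepFun_iff_measure_inter_preimage_eq_mul.1 hind I fun _ _ => hs,
        ← (Finset.mem_powersetCard.1 hI).2]
      exact Finset.prod_le_pow_card _ _ _ fun i _ => hsucc i
    _ = (n.choose q : ENNReal) * ENNReal.ofReal p ^ q := by simp
    _ ≤ (n : ENNReal) ^ q * ENNReal.ofReal p ^ q := by
      gcongr
      exact_mod_cast Nat.choose_le_pow n q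
    _ = _ := by
      rw [mul_pow, ENNReal.ofReal_mul (by positivity), ENNReal.ofReal_pow (by positivity),
        ENNReal.ofReal_pow hp0, ENNReal.ofReal_natCast]

end Counting

/-! ### Hits of a node under uniform sampling -/

section Sampling

variable {N n : ℕ} {W : Type*} [DecidableEq W]

instance isProbabilityMeasure_uniformSamples [NeZero N] :
    IsProbabilityMeasure (uniformSamples N n) := by
  unfold uniformSamples; infer_instance

theorem uniformSamples_eval_preimage [NeZero N] (E : Finset (Fin N × W)) (w : W) (i : Fin n) :
    (uniformSamples N n).real ((fun v : Fin n → Fin N => v i) ⁻¹' {v | (v, w) ∈ E}) =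
      inDeg E w / N := by
  have hmp := measurePreserving_eval (fun _ : Fin n => (uniformOn Set.univ : Measure (Fin N))) i
  have hset : {v : Fin N | (v, w) ∈ E} = (Finset.univ.filter fun v => (v, w) ∈ E : Finset _) := by
    ext; simp
  have h := hmp.measureReal_preimage
    (MeasurableSet.of_discrete (s := {v | (v, w) ∈ E})).nullMeasurableSet
  refine h.trans ?_
  rw [measureReal_def, uniformOn_univ, hset, Measure.count_apply_finset, ENNReal.toReal_div]
  simp [inDeg]

theorem iIndepFun_uniformSamples [NeZero N] :
    iIndepFun (fun (i : Fin n) (v : Fin n → Fin N) => v i) (uniformSamples N n) :=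
  iIndepFun_pi (X := fun _ v => v) fun _ => aemeasurable_id

theorem uniformSamples_hits_lt_le [NeZero N] (E : Finset (Fin N × W)) (w : W) {q m : ℕ} :
    uniformSamples N (q * m) {v | hits E v w < q} ≤
      ENNReal.ofReal (q * Real.exp (-(inDeg E w / N * m))) :=
  measure_card_lt_le (s := {v | (v, w) ∈ E}) (fun i => measurable_pi_apply i)
    iIndepFun_uniformSamples MeasurableSet.of_discrete
    (fun i => (uniformSamples_eval_preimage E w i).ge) le_rfl

theorem uniformSamples_le_hits_le [NeZero N] (E : Finset (Fin N × W)) (w : W) (q : ℕ) :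
    uniformSamples N n {v | q ≤ hits E v w} ≤
      ENNReal.ofReal (min 1 ((n * (inDeg E w / N)) ^ q)) := by
  rw [ENNReal.ofReal_min, ENNReal.ofReal_one]
  exact le_min prob_le_one <| measure_le_card_le (s := {v | (v, w) ∈ E}) iIndepFun_uniformSamples
    MeasurableSet.of_discrete (by positivity)
    (fun i => (uniformSamples_eval_preimage E w i).le) q

end Sampling

/-! ### Truncated moments -/

section Moment

variable {ν : Measure ℕ}

theorem measure_lt_eq_ofReal_tailFun [IsProbabilityMeasure ν] (x : ℝ) :
    ν {j : ℕ | x < j} = ENNReal.ofReal (tailFun ν x) := by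
  rw [tailFun_eq_measureReal, ofReal_measureReal]

/-- Dyadic domination of a truncated power. -/
theorem min_one_pow_le_tsum {z : ℝ} (hz : 0 ≤ z) {q : ℕ} (hq : q ≠ 0) :
    ENNReal.ofReal (min 1 (z ^ q)) ≤
      ∑' i : ℕ, {u : ℝ | 1 / 2 ^ (i + 1) < u}.indicator
        (fun _ => ENNReal.ofReal ((1 / 2 ^ i) ^ q)) z := by
  rcases hz.eq_or_lt with rfl | hz
  · simp [zero_pow hq]
  rcases lt_or_ge 1 z with h1 | h1
  · refine le_trans ?_ (ENNReal.le_tsum 0)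
    rw [Set.indicator_of_mem (by simp; linarith)]
    exact ENNReal.ofReal_le_ofReal (by simp)
  · obtain ⟨i, hi, hi'⟩ := exists_nat_pow_near_of_lt_one hz h1 (by norm_num : (0 : ℝ) < 1 / 2)
      (by norm_num)
    refine le_trans ?_ (ENNReal.le_tsum i)
    rw [Set.indicator_of_mem (by simpa using hi)]
    refine ENNReal.ofReal_le_ofReal ((min_le_right _ _).trans ?_)
    gcongr
    simpa using hi'

/-- Truncated moments of an order above the tail exponent: the expected sum of
`min 1 ((ξ_w / a(M)) ^ q)` over `M` nodes `w` is bounded. -/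
theorem RegularlyVaryingTail.exists_moment_bound [IsProbabilityMeasure ν] {γ : ℝ}
    (hν : RegularlyVaryingTail ν γ) :
    ∃ (K : ℝ) (q : ℕ), 0 < K ∧ 0 < q ∧ ∀ y : ℝ, 0 < y → 0 < tailInverse ν y →
      ENNReal.ofReal y * ∫⁻ j, ENNReal.ofReal (min 1 ((j / tailInverse ν y) ^ q)) ∂ν ≤
        ENNReal.ofReal K := by
  obtain ⟨C, β, hC, hCβ⟩ := hν.exists_dyadic_bound
  refine ⟨C * 2 ^ β * 2, β + 1, by positivity, by positivity, fun y hy ha => ?_⟩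
  set a := tailInverse ν y
  have hset : ∀ i : ℕ, {j : ℕ | 1 / 2 ^ (i + 1) < (j : ℝ) / a} = {j : ℕ | a / 2 ^ (i + 1) < j} := by
    intro i
    ext j
    simp only [Set.mem_ofPred_eq]
    rw [lt_div_iff₀ ha, one_div_mul_eq_div]
  calc _ ≤ ENNReal.ofReal y * ∫⁻ j : ℕ, ∑' i : ℕ, {j : ℕ | a / 2 ^ (i + 1) < j}.indicator
        (fun _ => ENNReal.ofReal ((1 / 2 ^ i) ^ (β + 1))) j ∂ν := by
        gcongr with j
        refine (min_one_pow_le_tsum (by positivity) β.succ_ne_zero).trans (le_of_eq ?_)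
        refine tsum_congr fun i => ?_
        rw [← hset i]
        rfl
    _ = ∑' i : ℕ, ENNReal.ofReal y * (ENNReal.ofReal ((1 / 2 ^ i) ^ (β + 1)) *
        ENNReal.ofReal (tailFun ν (a / 2 ^ (i + 1)))) := by
        rw [lintegral_tsum fun i => (measurable_of_countable _).aemeasurable, ENNReal.tsum_mul_left]
        congr 1
        refine tsum_congr fun i => ?_
        rw [lintegral_indicator_const MeasurableSet.of_discrete, measure_lt_eq_ofReal_tailFun]
    _ ≤ ∑' i : ℕ, ENNReal.ofReal (C * 2 ^ β * (1 / 2) ^ i) := by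
        refine ENNReal.tsum_le_tsum fun i => ?_
        rw [← ENNReal.ofReal_mul (by positivity), ← ENNReal.ofReal_mul hy.le]
        refine ENNReal.ofReal_le_ofReal ?_
        calc _ = (1 / 2 ^ i) ^ (β + 1) * (y * tailFun ν (a / 2 ^ (i + 1))) := by ring
          _ ≤ (1 / 2 ^ i) ^ (β + 1) * (C * (2 ^ β) ^ (i + 1)) := by
            exact mul_le_mul_of_nonneg_left (hCβ y hy (i + 1)) (by positivity)
          _ = C * 2 ^ β * (1 / 2) ^ i := by
            have h2 : ((2 : ℝ) ^ i) ^ β = (2 ^ β) ^ i := by rw [← pow_mul, ← pow_mul, mul_comm]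
            have h3 : (2 : ℝ) ^ i ≠ 0 := by positivity
            have h4 : ((2 : ℝ) ^ β) ^ i ≠ 0 := by positivity
            rw [div_pow, div_pow, one_pow, one_pow, pow_succ, h2, pow_succ]
            field_simp
    _ = _ := by
        rw [← ENNReal.ofReal_tsum_of_nonneg (fun i => by positivity)
          (summable_geometric_two.mul_left _), tsum_mul_left, tsum_geometric_two]

end Moment

/-! ### The probability of failure -/

section RandomGraph

variable {Ω : Type*} [MeasurableSpace Ω] {M N n : ℕ} {E : Ω → Finset (Fin N × Fin M)}

theorem measurableSet_graph_eq (hE : ∀ e, MeasurableSet {ω | e ∈ E ω})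
    (F : Finset (Fin N × Fin M)) : MeasurableSet {ω | E ω = F} := by
  have h : {ω | E ω = F} = ⋂ e, {ω | e ∈ E ω ↔ e ∈ F} := by
    ext ω
    simp only [Set.mem_ofPred_eq, Set.mem_iInter, Finset.ext_iff]
  rw [h]
  exact MeasurableSet.iInter fun e => (hE e).iff (MeasurableSet.const _)

/-- Every event that is determined by the graph and the samples is measurable, as there are only
finitely many graphs and samples. -/
theorem measurableSet_graph_samples (hE : ∀ e, MeasurableSet {ω | e ∈ E ω})
    (R : Finset (Fin N × Fin M) → (Fin n → Fin N) → Prop) :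
    MeasurableSet {x : Ω × (Fin n → Fin N) | R (E x.1) x.2} := by
  have h : {x : Ω × (Fin n → Fin N) | R (E x.1) x.2} =
      ⋃ (F) (v) (_ : R F v), {ω | E ω = F} ×ˢ {v} := by
    ext ⟨ω, v⟩
    simp
  rw [h]
  exact MeasurableSet.iUnion fun F => MeasurableSet.iUnion fun v => MeasurableSet.iUnion fun _ =>
    (measurableSet_graph_eq hE F).prod (MeasurableSet.singleton v)

theorem prod_uniformSamples_apply [NeZero N] (hE : ∀ e, MeasurableSet {ω | e ∈ E ω})
    (Q : Measure Ω) (R : Finset (Fin N × Fin M) → (Fin n → Fin N) → Prop) :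
    (Q.prod (uniformSamples N n)) {x | R (E x.1) x.2} =
      ∫⁻ ω, uniformSamples N n {v | R (E ω) v} ∂Q :=
  Measure.prod_apply (measurableSet_graph_samples hE R)

/-- The probability of failure on the part `Q` of the probability space where the in-degrees are
the `ξ w`. The three terms bound the probabilities that fewer than `k` nodes have an in-degree
`> x`, that one of these is hit fewer than `q` times, and, by Markov's inequality, that more than
`n₂` nodes are hit at least `q` times. -/
theorem prod_not_findsTop_le [NeZero N] {P Q : Measure Ω} [SFinite Q] {ν : Measure ℕ}
    {ξ : Fin M → Ω → ℕ} (hQP : Q ≤ P) (hξ : ∀ w, Measurable (ξ w)) (hlaw : ∀ w, P.map (ξ w) = ν)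
    (hE : ∀ e, MeasurableSet {ω | e ∈ E ω}) (hdeg : ∀ᵐ ω ∂Q, ∀ w, inDeg (E ω) w = ξ w ω)
    {k q m n₂ : ℕ} {ε B x : ℝ} (hε : 0 ≤ ε) (hB : ((q * m + n₂ : ℕ) : ℝ) ≤ B) :
    (Q.prod (uniformSamples N (q * m)))
        {z | ¬ FindsTop k ε B n₂ (E z.1) (List.ofFn z.2)} ≤
      P {ω | (Finset.univ.filter fun w => x < ξ w ω).card < k} +
      M * (ENNReal.ofReal (q * Real.exp (-(x / N * m))) * ν {j : ℕ | x < j}) +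
      (M * ∫⁻ j, ENNReal.ofReal (min 1 (((q * m : ℕ) * (j / N : ℝ)) ^ q)) ∂ν) / (n₂ + 1) := by
  let U := uniformSamples N (q * m)
  let few := {z : Ω × (Fin (q * m) → Fin N) |
    (Finset.univ.filter fun w => x < inDeg (E z.1) w).card < k}
  let missed := fun w => {z : Ω × (Fin (q * m) → Fin N) |
    x < inDeg (E z.1) w ∧ hits (E z.1) z.2 w < q}
  let many := {z : Ω × (Fin (q * m) → Fin N) |
    n₂ < (Finset.univ.filter fun w => q ≤ hits (E z.1) z.2 w).card}
  have hsub : {z : Ω × (Fin (q * m) → Fin N) |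
      ¬ FindsTop k ε B n₂ (E z.1) (List.ofFn z.2)} ⊆ (few ∪ ⋃ w, missed w) ∪ many := by
    intro z hz
    by_contra hnot
    simp only [few, missed, many, Set.mem_union, Set.mem_iUnion, Set.mem_ofPred_eq, not_or,
      not_exists, not_and, not_lt] at hnot
    exact hz (findsTop_of_hits hε hB hnot.1.1 hnot.1.2 hnot.2)
  have hmap : ∀ (w : Fin M) (f : ℕ → ENNReal), ∫⁻ ω, f (ξ w ω) ∂Q ≤ ∫⁻ j, f j ∂ν := by
    intro w f
    rw [← hlaw w, lintegral_map (measurable_of_countable f) (hξ w)]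
    exact lintegral_mono' hQP le_rfl
  have hfew : (Q.prod U) few ≤ P {ω | (Finset.univ.filter fun w => x < ξ w ω).card < k} := by
    have hset : MeasurableSet {ω | (Finset.univ.filter fun w => x < ξ w ω).card < k} := by
      have : Measurable fun ω w => ξ w ω := measurable_pi_lambda _ hξ
      exact this (MeasurableSet.of_discrete
        (s := {f : Fin M → ℕ | (Finset.univ.filter fun w => x < f w).card < k}))
    rw [prod_uniformSamples_apply hE Q
      (fun F _ => (Finset.univ.filter fun w => x < inDeg F w).card < k)]
    calc _ ≤ ∫⁻ ω, {ω | (Finset.univ.filter fun w => x < ξ w ω).card < k}.indicator 1 ω ∂Q := by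
          refine lintegral_mono_ae ?_
          filter_upwards [hdeg] with ω hω
          by_cases h : (Finset.univ.filter fun w => x < ξ w ω).card < k <;> simp [hω, h]
      _ = Q _ := lintegral_indicator_one hset
      _ ≤ _ := hQP _
  have hmissed : (Q.prod U) (⋃ w, missed w) ≤
      M * (ENNReal.ofReal (q * Real.exp (-(x / N * m))) * ν {j : ℕ | x < j}) := by
    refine (measure_iUnion_fintype_le _ _).trans ?_
    refine (Finset.sum_le_card_nsmul _ _
      (ENNReal.ofReal (q * Real.exp (-(x / N * m))) * ν {j : ℕ | x < j}) fun w _ => ?_).trans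
      (by simp)
    rw [prod_uniformSamples_apply hE Q fun F v => x < inDeg F w ∧ hits F v w < q,
      ← lintegral_indicator_const MeasurableSet.of_discrete]
    refine le_trans (lintegral_mono_ae ?_) (hmap w _)
    filter_upwards [hdeg] with ω hω
    by_cases h : x < ξ w ω
    · rw [Set.indicator_of_mem (show ξ w ω ∈ {j : ℕ | x < j} from h)]
      refine (measure_mono fun v hv => hv.2).trans ((uniformSamples_hits_lt_le (E ω) w).trans ?_)
      rw [hω w]
      gcongr
    · simp [hω w, h]
  have hmany : (Q.prod U) many ≤
      (M * ∫⁻ j, ENNReal.ofReal (min 1 (((q * m : ℕ) * (j / N : ℝ)) ^ q)) ∂ν) / (n₂ + 1) := by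
    have hmeas : ∀ w, MeasurableSet {z : Ω × (Fin (q * m) → Fin N) | q ≤ hits (E z.1) z.2 w} :=
      fun w => measurableSet_graph_samples hE fun F v => q ≤ hits F v w
    have hcard : ∀ z : Ω × (Fin (q * m) → Fin N),
        ((Finset.univ.filter fun w => q ≤ hits (E z.1) z.2 w).card : ENNReal) =
        ∑ w, {z : Ω × (Fin (q * m) → Fin N) | q ≤ hits (E z.1) z.2 w}.indicator 1 z := by
      intro z
      simp [Set.indicator_apply, Finset.sum_boole]
    have hmarkov : many ⊆ {z | (n₂ + 1 : ENNReal) ≤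
        ∑ w, {z : Ω × (Fin (q * m) → Fin N) | q ≤ hits (E z.1) z.2 w}.indicator 1 z} := by
      intro z hz
      rw [Set.mem_ofPred_eq, ← hcard z]
      exact_mod_cast hz
    refine (measure_mono hmarkov).trans
      ((meas_ge_le_lintegral_div ?_ (by simp) (by finiteness)).trans ?_)
    · exact (Finset.measurable_fun_sum _ fun w _ => measurable_one.indicator (hmeas w)).aemeasurable
    · gcongr
      rw [lintegral_finsetSum _ fun w _ => measurable_one.indicator (hmeas w)]
      refine (Finset.sum_le_card_nsmul _ _
        (∫⁻ j, ENNReal.ofReal (min 1 (((q * m : ℕ) * (j / N : ℝ)) ^ q)) ∂ν) fun w _ => ?_).trans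
        (by rw [Finset.card_univ, Fintype.card_fin, nsmul_eq_mul])
      rw [lintegral_indicator_one (hmeas w),
        prod_uniformSamples_apply hE Q fun F v => q ≤ hits F v w]
      refine le_trans (lintegral_mono_ae ?_) (hmap w _)
      filter_upwards [hdeg] with ω hω
      rw [← hω w]
      exact uniformSamples_le_hits_le (E ω) w q
  calc _ ≤ _ := measure_mono hsub
    _ ≤ (Q.prod U) few + (Q.prod U) (⋃ w, missed w) + (Q.prod U) many :=
      (measure_union_le _ _).trans (add_le_add_left (measure_union_le _ _) _)
    _ ≤ _ := add_le_add (add_le_add hfew hmissed) hmany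

end RandomGraph

/-! ### The event that no degree exceeds the number of source nodes -/

section Conditioning

variable {Ω : Type*} [MeasurableSpace Ω] {P : Measure Ω} {ν : Measure ℕ}
  [IsProbabilityMeasure ν] {M : ℕ} {ξ : Fin M → Ω → ℕ}

theorem exp_neg_two_mul_le_one_sub {t : ℝ} (h0 : 0 ≤ t) (h1 : t ≤ 1 / 2) :
    Real.exp (-(2 * t)) ≤ 1 - t := by
  rw [Real.exp_neg, inv_le_comm₀ (Real.exp_pos _) (by linarith)]
  refine le_trans ?_ (Real.add_one_le_exp (2 * t))
  rw [inv_le_iff_one_le_mul₀ (by linarith)]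
  nlinarith

theorem measurableSet_forall_le (hξ : ∀ w, Measurable (ξ w)) (N : ℕ) :
    MeasurableSet {ω | ∀ w, ξ w ω ≤ N} := by
  have h : {ω | ∀ w, ξ w ω ≤ N} = ⋂ w, ξ w ⁻¹' {j | j ≤ N} := by
    ext; simp
  rw [h]
  exact MeasurableSet.iInter fun w => hξ w MeasurableSet.of_discrete

/-- The probability that no degree exceeds `N` is bounded below when the expected number of degrees
above `N` is bounded. -/
theorem exp_le_measureReal_forall_le [IsProbabilityMeasure P] (hξ : ∀ w, Measurable (ξ w))
    (hind : iIndepFun ξ P) (hlaw : ∀ w, P.map (ξ w) = ν) {N : ℕ} {K : ℝ}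
    (hN : tailFun ν N ≤ 1 / 2) (hK : M * tailFun ν N ≤ K) :
    Real.exp (-(2 * K)) ≤ P.real {ω | ∀ w, ξ w ω ≤ N} := by
  have h : {ω | ∀ w, ξ w ω ≤ N} = ⋂ w ∈ Finset.univ, ξ w ⁻¹' {j | j ≤ N} := by
    ext; simp
  have hcompl : {j : ℕ | j ≤ N} = {j : ℕ | (N : ℝ) < j}ᶜ := by
    ext; simp
  rw [measureReal_def, h, iIndepFun_iff_measure_inter_preimage_eq_mul.1 hind Finset.univ
    fun _ _ => MeasurableSet.of_discrete, ENNReal.toReal_prod]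
  have hone : ∀ w, (P (ξ w ⁻¹' {j | j ≤ N})).toReal = 1 - tailFun ν N := fun w => by
    rw [← Measure.map_apply (hξ w) MeasurableSet.of_discrete, hlaw w, ← measureReal_def, hcompl,
      probReal_compl_eq_one_sub MeasurableSet.of_discrete, tailFun_eq_measureReal]
  simp only [hone, Finset.prod_const, Finset.card_univ, Fintype.card_fin]
  calc _ ≤ Real.exp (-(2 * tailFun ν N)) ^ M := by
        rw [← Real.exp_nat_mul]
        exact Real.exp_le_exp.2 (by linarith)
    _ ≤ _ := pow_le_pow_left₀ (Real.exp_pos _).le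
        (exp_neg_two_mul_le_one_sub (tailFun_nonneg ν N) hN) M

theorem measure_compl_forall_le_le (hξ : ∀ w, Measurable (ξ w)) (hlaw : ∀ w, P.map (ξ w) = ν)
    (N : ℕ) : P {ω | ∀ w, ξ w ω ≤ N}ᶜ ≤ ENNReal.ofReal (M * tailFun ν N) := by
  have h : {ω | ∀ w, ξ w ω ≤ N}ᶜ = ⋃ w, ξ w ⁻¹' {j : ℕ | (N : ℝ) < j} := by
    ext; simp
  rw [h]
  refine (measure_iUnion_fintype_le _ _).trans (le_of_eq ?_)
  have hone : ∀ w, P (ξ w ⁻¹' {j : ℕ | (N : ℝ) < j}) = ENNReal.ofReal (tailFun ν N) := fun w => by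
    rw [← Measure.map_apply (hξ w) MeasurableSet.of_discrete, hlaw w, measure_lt_eq_ofReal_tailFun]
  simp only [hone, Finset.sum_const, Finset.card_univ, Fintype.card_fin, nsmul_eq_mul]
  rw [ENNReal.ofReal_mul (Nat.cast_nonneg M), ENNReal.ofReal_natCast]

end Conditioning

/-! ### Choice of the parameters -/

section Parameters

variable {ν : Measure ℕ} {γ : ℝ}

theorem exists_rpow_eq (hγ : 0 < γ) {r : ℝ} (hr : 0 < r) : ∃ x : ℝ, 0 < x ∧ x ^ (-1 / γ) = r :=
  ⟨r ^ (-γ), Real.rpow_pos_of_pos hr _, by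
    rw [← Real.rpow_mul hr.le, neg_mul_comm, neg_div, neg_neg, mul_div_cancel₀ _ hγ.ne',
      Real.rpow_one]⟩

theorem exists_mul_exp_neg_mul_le (b : ℝ) {s η : ℝ} (hs : 0 < s) (hη : 0 < η) :
    ∃ R : ℝ, 0 < R ∧ b * Real.exp (-(s * R)) ≤ η := by
  have h : Tendsto (fun R : ℝ => b * Real.exp (-(s * R))) atTop (𝓝 (b * 0)) :=
    (Real.tendsto_exp_neg_atTop_nhds_zero.comp (tendsto_id.const_mul_atTop hs)).const_mul b
  rw [mul_zero] at h
  obtain ⟨R, hR, hR0⟩ := ((h.eventually_le_const hη).and (eventually_gt_atTop 0)).exists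
  exact ⟨R, hR0, hR⟩

/-- Among `M` independent degrees, with high probability at least `k` exceed a level `x` for which
the expected number `M (1 - G(x))` of such degrees is large. -/
theorem measure_card_lt_le_exp [IsProbabilityMeasure ν] {Ω : Type*} [MeasurableSpace Ω]
    {P : Measure Ω} [IsProbabilityMeasure P] {M k : ℕ} {ξ : Fin M → Ω → ℕ}
    (hξ : ∀ w, Measurable (ξ w)) (hind : iIndepFun ξ P) (hlaw : ∀ w, P.map (ξ w) = ν) (hk : 0 < k)
    (hM : 2 * k ≤ M) {x R : ℝ} (hR : R ≤ M * tailFun ν x) :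
    P {ω | (Finset.univ.filter fun w => x < ξ w ω).card < k} ≤
      ENNReal.ofReal (k * Real.exp (-(1 / (2 * k) * R))) := by
  have h := measure_card_lt_le (μ := P) (s := {j : ℕ | x < j}) (p := tailFun ν x) (q := k)
    (m := M / k) hξ hind MeasurableSet.of_discrete (fun w => by
      rw [tailFun_eq_measureReal, ← hlaw w, map_measureReal_apply (hξ w) MeasurableSet.of_discrete])
    (Nat.mul_div_le M k)
  refine h.trans (ENNReal.ofReal_le_ofReal ?_)
  have hdiv : (M : ℝ) / (2 * k) ≤ (M / k : ℕ) := by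
    rw [div_le_iff₀ (by positivity)]
    have h1 : M < (M / k + 1) * k := Nat.lt_mul_of_div_lt (Nat.lt_succ_self _) hk
    have h2 : M ≤ M / k * (2 * k) := by nlinarith
    exact_mod_cast h2
  refine mul_le_mul_of_nonneg_left (Real.exp_le_exp.2 (neg_le_neg ?_)) (Nat.cast_nonneg k)
  calc 1 / (2 * k) * R ≤ 1 / (2 * k) * (M * tailFun ν x) := by gcongr
    _ = tailFun ν x * (M / (2 * k)) := by ring
    _ ≤ _ := mul_le_mul_of_nonneg_left hdiv (tailFun_nonneg ν x)

theorem min_one_mul_pow_le {D : ℝ} (hD : 1 ≤ D) (z : ℝ) (q : ℕ) :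
    min 1 ((D * z) ^ q) ≤ D ^ q * min 1 (z ^ q) := by
  rw [mul_min_of_nonneg _ _ (by positivity), mul_pow, mul_one]
  exact min_le_min (one_le_pow₀ hD) le_rfl

/-- Choice of the parameters: `O(N / a(M))` requests suffice for any prescribed bound on the
probability of failure on the part `Q` of the probability space where the in-degrees are the
`ξ w`. -/
theorem RegularlyVaryingTail.exists_parameters [IsProbabilityMeasure ν] (hγ : 0 < γ)
    (hν : RegularlyVaryingTail ν γ) {k : ℕ} {c η : ℝ} (hk : 0 < k) (hc : 0 < c) (hη : 0 < η) :
    ∃ (C : ℝ) (M₀ : ℕ), 0 < C ∧ ∀ M N : ℕ, M₀ ≤ M → M₀ ≤ N → c * tailInverse ν M ≤ N →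
      ∃ n₁ n₂ : ℕ, n₂ ≤ M ∧ ((n₁ + n₂ : ℕ) : ℝ) ≤ C * (N / tailInverse ν M) ∧
        ∀ (Ω : Type*) [MeasurableSpace Ω] (P Q : Measure Ω) [IsProbabilityMeasure P] [SFinite Q]
          (ξ : Fin M → Ω → ℕ) (E : Ω → Finset (Fin N × Fin M)) (ε : ℝ),
          0 ≤ ε → Q ≤ P →
          (∀ w, Measurable (ξ w)) → iIndepFun ξ P → (∀ w, P.map (ξ w) = ν) →
          (∀ e, MeasurableSet {ω | e ∈ E ω}) → (∀ᵐ ω ∂Q, ∀ w, inDeg (E ω) w = ξ w ω) →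
          (Q.prod (uniformSamples N n₁)) {z | ¬ FindsTop k ε (C * (N / tailInverse ν M)) n₂
            (E z.1) (List.ofFn z.2)} ≤ ENNReal.ofReal η := by
  obtain ⟨K, q, hK, hq, hmoment⟩ := hν.exists_moment_bound
  have hk' : (0 : ℝ) < k := Nat.cast_pos.2 hk
  obtain ⟨R, hR, hRη⟩ := exists_mul_exp_neg_mul_le k (s := 1 / (2 * k)) (η := η / 3)
    (by positivity) (by positivity)
  -- The level `x a(M)` is exceeded by about `R + 1` of the `M` degrees.
  obtain ⟨x, hx, hxR⟩ := exists_rpow_eq hγ (by positivity : 0 < R + 1)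
  obtain ⟨C₁, hC₁, hCη⟩ := exists_mul_exp_neg_mul_le (q * (R + 2)) (η := η / 3) hx (by positivity)
  -- With `n₁ = q m` and `m = ⌈C₁ N / a(M)⌉`, a node of degree `d` is hit `n₁ d / N ≤ D d / a(M)`
  -- times on average.
  set D : ℝ := max 1 (q * (C₁ + 1 / c)) with hD
  have hD1 : 1 ≤ D := le_max_left _ _
  -- Markov's inequality for the number of nodes hit at least `q` times, whose expectation is at
  -- most `D ^ q * K`.
  obtain ⟨n₂, hn₂⟩ := exists_nat_gt (D ^ q * K / (η / 3))
  have hlim := hν.tendsto_mul_tailFun hx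
  rw [hxR] at hlim
  have hev := tendsto_natCast_atTop_atTop (R := ℝ) |>.eventually
    (((hlim.eventually_const_le (by linarith : R < R + 1)).and
      (hlim.eventually_le_const (by linarith : R + 1 < R + 2))).and
      (hν.tendsto_tailInverse.eventually_gt_atTop 0))
  obtain ⟨M₀, hM₀⟩ := eventually_atTop.1 hev
  have hq' : (0 : ℝ) < q := Nat.cast_pos.2 hq
  refine ⟨q * (C₁ + 1 / c) + n₂ / c, max M₀ (max n₂ (2 * k)), by positivity,
    fun M N hM hN hMN => ?_⟩
  obtain ⟨⟨hlow, hupp⟩, ha⟩ := hM₀ M ((le_max_left _ _).trans hM)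
  have hMn : n₂ ≤ M := (le_max_left _ _).trans ((le_max_right _ _).trans hM)
  have hMk : 2 * k ≤ M := (le_max_right _ _).trans ((le_max_right _ _).trans hM)
  have hNk : 2 * k ≤ N := (le_max_right _ _).trans ((le_max_right _ _).trans hN)
  have : NeZero N := ⟨by omega⟩
  have hN0 : (0 : ℝ) < N := Nat.cast_pos.2 (by omega)
  have hM0 : (0 : ℝ) < M := Nat.cast_pos.2 (by omega)
  set a := tailInverse ν M
  have hca : c ≤ N / a := (le_div_iff₀ ha).2 hMN
  -- Constants are `O(N / a(M))`.
  have hone : 1 ≤ 1 / c * (N / a) := by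
    rw [one_div, inv_mul_eq_div, one_le_div hc]
    exact hca
  set m := ⌈C₁ * (N / a)⌉₊
  have hm : C₁ * (N / a) ≤ m := Nat.le_ceil _
  have hm' : (m : ℝ) ≤ (C₁ + 1 / c) * (N / a) := by
    have := (Nat.ceil_lt_add_one (show 0 ≤ C₁ * (N / a) by positivity)).le
    linarith
  have hB : ((q * m + n₂ : ℕ) : ℝ) ≤ (q * (C₁ + 1 / c) + n₂ / c) * (N / a) := by
    push_cast
    have h1 : (n₂ : ℝ) ≤ n₂ * (1 / c * (N / a)) := le_mul_of_one_le_right (by positivity) hone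
    have h2 : (q : ℝ) * m ≤ q * ((C₁ + 1 / c) * (N / a)) := by gcongr
    calc _ ≤ _ := add_le_add h2 h1
      _ = _ := by ring
  refine ⟨q * m, n₂, hMn, hB, ?_⟩
  intro Ω _ P Q _ _ ξ E ε hε hQP hξ hind hlaw hE hdeg
  refine (prod_not_findsTop_le (x := x * a) hQP hξ hlaw hE hdeg hε hB).trans ?_
  have h1 : P {ω | (Finset.univ.filter fun w => x * a < ξ w ω).card < k} ≤
      ENNReal.ofReal (η / 3) :=
    (measure_card_lt_le_exp hξ hind hlaw hk hMk hlow).trans (ENNReal.ofReal_le_ofReal hRη)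
  have h2 : M * (ENNReal.ofReal (q * Real.exp (-(x * a / N * m))) * ν {j : ℕ | x * a < j}) ≤
      ENNReal.ofReal (η / 3) := by
    rw [measure_lt_eq_ofReal_tailFun, ← ENNReal.ofReal_natCast M,
      ← ENNReal.ofReal_mul (by positivity), ← ENNReal.ofReal_mul (by positivity)]
    refine ENNReal.ofReal_le_ofReal (le_trans ?_ hCη)
    have hexp : x * C₁ ≤ x * a / N * m := by
      calc x * C₁ = x * a / N * (C₁ * (N / a)) := by field_simp
        _ ≤ _ := by gcongr
    calc _ = q * (M * tailFun ν (x * a)) * Real.exp (-(x * a / N * m)) := by ring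
      _ ≤ _ := by gcongr
  have h3 : (M * ∫⁻ j, ENNReal.ofReal (min 1 (((q * m : ℕ) * (j / N : ℝ)) ^ q)) ∂ν) / (n₂ + 1) ≤
      ENNReal.ofReal (η / 3) := by
    have hpt : ∀ j : ℕ, ENNReal.ofReal (min 1 (((q * m : ℕ) * (j / N : ℝ)) ^ q)) ≤
        ENNReal.ofReal (D ^ q) * ENNReal.ofReal (min 1 ((j / a) ^ q)) := by
      intro j
      rw [← ENNReal.ofReal_mul (by positivity)]
      refine ENNReal.ofReal_le_ofReal (le_trans ?_ (min_one_mul_pow_le hD1 (j / a) q))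
      refine min_le_min le_rfl (pow_le_pow_left₀ (by positivity) ?_ q)
      push_cast
      calc (q : ℝ) * m * (j / N) ≤ q * ((C₁ + 1 / c) * (N / a)) * (j / N) := by gcongr
        _ = q * (C₁ + 1 / c) * (j / a) := by field_simp
        _ ≤ D * (j / a) := by
          gcongr
          exact le_max_right _ _
    refine ENNReal.div_le_of_le_mul ?_
    calc _ ≤ M * ∫⁻ j : ℕ, ENNReal.ofReal (D ^ q) * ENNReal.ofReal (min 1 ((j / a) ^ q)) ∂ν := by
          gcongr with j
          exact hpt j
      _ = ENNReal.ofReal (D ^ q) *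
          (ENNReal.ofReal M * ∫⁻ j : ℕ, ENNReal.ofReal (min 1 ((j / a) ^ q)) ∂ν) := by
          rw [lintegral_const_mul _ (measurable_of_countable _), ENNReal.ofReal_natCast]
          ring
      _ ≤ ENNReal.ofReal (D ^ q) * ENNReal.ofReal K := by
          gcongr
          exact hmoment M hM0 ha
      _ = ENNReal.ofReal (D ^ q * K) := (ENNReal.ofReal_mul (by positivity)).symm
      _ ≤ ENNReal.ofReal (η / 3 * (n₂ + 1)) := by
          refine ENNReal.ofReal_le_ofReal ?_
          rw [div_lt_iff₀ (by positivity)] at hn₂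
          linarith
      _ = _ := by
          rw [ENNReal.ofReal_mul (by positivity), ENNReal.ofReal_add (by positivity) zero_le_one,
            ENNReal.ofReal_natCast, ENNReal.ofReal_one]
  calc _ ≤ _ := add_le_add (add_le_add h1 h2) h3
    _ = ENNReal.ofReal η := by
      rw [← ENNReal.ofReal_add (by positivity) (by positivity),
        ← ENNReal.ofReal_add (by positivity) (by positivity)]
      congr 1
      ring

end Parameters

/-- No measurability is needed: outer measures are subadditive. -/
theorem one_sub_le_measureReal_of_compl_le {α : Type*} [MeasurableSpace α] {μ : Measure α}
    [IsProbabilityMeasure μ] {p : α → Prop} {δ : ℝ} (hδ : 0 ≤ δ)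
    (h : μ {x | ¬ p x} ≤ ENNReal.ofReal δ) : 1 - δ ≤ μ.real {x | p x} := by
  have hreal : μ.real {x | ¬ p x} ≤ δ := ENNReal.toReal_le_of_le_ofReal hδ h
  have hunion : {x | p x} ∪ {x | ¬ p x} = Set.univ := by
    ext x; simpa using em (p x)
  have := measureReal_union_le (μ := μ) {x | p x} {x | ¬ p x}
  rw [hunion, probReal_univ] at this
  linarith

/-! ### Finding the top-k nodes -/

theorem mainTheorem1 (ν : Measure ℕ) [IsProbabilityMeasure ν] (γ : ℝ) (hγ : 0 < γ)
    (hν : RegularlyVaryingTail ν γ) :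
    (∃ l : ℝ → ℝ, SlowlyVarying l ∧ ∀ y : ℝ, 0 < y → tailInverse ν y = l y * y ^ γ) ∧
    ((fun N : ℕ => (N : ℝ) / tailInverse ν N) =o[atTop] fun N : ℕ => (N : ℝ)) ∧
    ∀ (k : ℕ) (ε δ c : ℝ), 0 < k → 0 < ε → 0 < δ → 0 < c →
      ∃ (C c₀ : ℝ) (M₀ : ℕ), 0 < C ∧ 0 < c₀ ∧
        ∀ M N : ℕ, M₀ ≤ M → M₀ ≤ N → c * tailInverse ν M ≤ N →
          ∃ n₁ n₂ : ℕ, n₂ ≤ M ∧ ((n₁ + n₂ : ℕ) : ℝ) ≤ C * (N / tailInverse ν M) ∧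
            ∀ (Ω : Type*) [MeasurableSpace Ω] (P : Measure Ω) [IsProbabilityMeasure P]
              (ξ : Fin M → Ω → ℕ) (E : Ω → Finset (Fin N × Fin M)),
              (∀ w, Measurable (ξ w)) → iIndepFun ξ P → (∀ w, P.map (ξ w) = ν) →
              (∀ e, MeasurableSet {ω | e ∈ E ω}) →
              (∀ᵐ ω ∂P, (∀ w, ξ w ω ≤ N) → ∀ w, inDeg (E ω) w = ξ w ω) →
              1 - δ ≤ ((cond P {ω | ∀ w, ξ w ω ≤ N}).prod (uniformSamples N n₁)).real
                  {x | FindsTop k ε (C * (N / tailInverse ν M)) n₂ (E x.1) (List.ofFn x.2)} ∧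
              (c₀ * tailInverse ν M ≤ N →
                1 - δ ≤ (P.prod (uniformSamples N n₁)).real
                  {x | FindsTop k ε (C * (N / tailInverse ν M)) n₂ (E x.1) (List.ofFn x.2)}) := by
  have hnat := tendsto_natCast_atTop_atTop (R := ℝ)
  refine ⟨hν.exists_slowlyVarying hγ, ?_, fun k ε δ c hk hε hδ hc => ?_⟩
  · refine (isLittleO_iff_tendsto' ?_).2 ?_
    · filter_upwards with N hN
      simp [hN]
    · refine (tendsto_inv_atTop_zero.comp (hν.tendsto_tailInverse.comp hnat)).congr' ?_
      filter_upwards [eventually_gt_atTop 0] with N hN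
      have : (N : ℝ) ≠ 0 := Nat.cast_ne_zero.2 hN.ne'
      simp only [Function.comp]
      rw [div_div_cancel_left' this]
  -- `P A` is bounded below by `exp (-2 K)`, which is what conditioning on `A` costs.
  set K : ℝ := c ^ (-1 / γ) + 1
  obtain ⟨c₀, hc₀, hc₀δ⟩ := exists_rpow_eq hγ (by positivity : 0 < δ / 4)
  obtain ⟨C, M₁, hC, hpar⟩ := hν.exists_parameters hγ (k := k) (c := c)
    (η := min (δ * Real.exp (-(2 * K))) (δ / 2)) hk hc (by positivity)
  have hlim := hν.tendsto_mul_tailFun hc₀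
  rw [hc₀δ] at hlim
  obtain ⟨M₂, hM₂⟩ := eventually_atTop.1 <| hnat.eventually <|
    ((hν.tendsto_mul_tailFun hc).eventually_le_const (lt_add_one _)).and <|
    (((tendsto_tailFun_atTop ν).comp (hν.tendsto_tailInverse.const_mul_atTop hc)
      ).eventually_le_const
      (by norm_num : (0 : ℝ) < 1 / 2)).and
    (hlim.eventually_le_const (by linarith : δ / 4 < δ / 2))
  refine ⟨C, c₀, max (max M₁ M₂) 1, hC, hc₀, fun M N hM hN hMN => ?_⟩
  have hM₁ : M₁ ≤ M := (le_max_left _ _).trans ((le_max_left _ _).trans hM)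
  have hN₁ : M₁ ≤ N := (le_max_left _ _).trans ((le_max_left _ _).trans hN)
  have : NeZero N := ⟨(lt_of_lt_of_le one_pos ((le_max_right _ _).trans hN)).ne'⟩
  obtain ⟨htail, hhalf, htail₀⟩ := hM₂ M ((le_max_right _ _).trans ((le_max_left _ _).trans hM))
  obtain ⟨n₁, n₂, hn₂, hn, hfail⟩ := hpar M N hM₁ hN₁ hMN
  refine ⟨n₁, n₂, hn₂, hn, ?_⟩
  intro Ω _ P _ ξ E hξ hind hlaw hE hdeg
  set A : Set Ω := {ω | ∀ w, ξ w ω ≤ N}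
  have hA : MeasurableSet A := measurableSet_forall_le hξ N
  have hPA : Real.exp (-(2 * K)) ≤ P.real A := by
    refine exp_le_measureReal_forall_le hξ hind hlaw ((tailFun_antitone ν hMN).trans hhalf) ?_
    exact (mul_le_mul_of_nonneg_left (tailFun_antitone ν hMN) (Nat.cast_nonneg M)).trans htail
  have hPA0 : 0 < P.real A := (Real.exp_pos _).trans_le hPA
  have hdegA : ∀ᵐ ω ∂(P.restrict A), ∀ w, inDeg (E ω) w = ξ w ω := by
    rw [ae_restrict_iff' hA]
    exact hdeg
  have hbad := hfail Ω P (P.restrict A) ξ E ε hε.le Measure.restrict_le_self hξ hind hlaw hE hdegA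
  refine ⟨?_, fun hc₀N => ?_⟩
  · have hPAne : P A ≠ 0 := fun h => by simp [measureReal_def, h] at hPA0
    have := cond_isProbabilityMeasure hPAne
    refine one_sub_le_measureReal_of_compl_le hδ.le ?_
    rw [ProbabilityTheory.cond, Measure.prod_smul_left, Measure.smul_apply, smul_eq_mul,
      ← ENNReal.div_eq_inv_mul]
    refine ENNReal.div_le_of_le_mul (hbad.trans ?_)
    rw [← ofReal_measureReal, ← ENNReal.ofReal_mul hδ.le]
    exact ENNReal.ofReal_le_ofReal ((min_le_left _ _).trans (by gcongr))
  · refine one_sub_le_measureReal_of_compl_le hδ.le ?_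
    have hcompl : P Aᶜ ≤ ENNReal.ofReal (δ / 2) := by
      refine (measure_compl_forall_le_le hξ hlaw N).trans (ENNReal.ofReal_le_ofReal ?_)
      exact (mul_le_mul_of_nonneg_left (tailFun_antitone ν hc₀N) (Nat.cast_nonneg M)).trans htail₀
    rw [← Measure.restrict_add_restrict_compl (μ := P) hA, Measure.add_prod, Measure.add_apply]
    calc _ ≤ ENNReal.ofReal (δ / 2) + ENNReal.ofReal (δ / 2) := by
          refine add_le_add (hbad.trans (ENNReal.ofReal_le_ofReal (min_le_right _ _))) ?_
          refine (measure_mono (Set.subset_univ _)).trans (le_trans (le_of_eq ?_) hcompl)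
          rw [← Set.univ_prod_univ, Measure.prod_prod, Measure.restrict_apply_univ,
            measure_univ, mul_one]
      _ = ENNReal.ofReal δ := by
          rw [← ENNReal.ofReal_add (by positivity) (by positivity), add_halves]
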